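/- Let $\mathbf v\in\mathbb R^3$ with $|\mathbf v|=1$, and let $\Pi=\mathbf v^{\perp}$ be the plane through the origin orthogonal to $\mathbf v$. Let $\Sigma\subset\mathbb R^3$ be a compact oriented smooth surface with boundary (corners on the boundary are allowed), with unit normal field (Gauss map) $N$ and mean curvature $H$, the sum of the principal curvatures, that is, the trace of the shape operator $-dN$. Suppose that * $\Sigma$ is a translating soliton with density vector $\mathbf v$: $H=\langle N,\mathbf v\rangle$ on $\Sigma$; * $\Sigma$ is a graph over a set $U\subset\Pi$: $\Sigma=\{x+u(x)\mathbf v : x\in U\}$ for a function $u$ that is smooth on $U$ (up to the boundary of $U$, which is compact because $\Sigma$ is). For a compact oriented surface $S$ immersed in $\mathbb R^3$, let $A_\phi(S)=\int_S e^{\langle x,\mathbf v\rangle}\,dA$ be its weighted area. Let $\mathcal C$ be the class of all compact oriented smooth immersed surfaces $\widetilde\Sigma$ in $\mathbb R^3$ with boundary (corners on the boundary allowed) such that $\widetilde\Sigma$ is included in the cylinder $U\times\mathbb R\mathbf v=\{x+t\mathbf v: x\in U,\ t\in\mathbb R\}$, $\partial\widetilde\Sigma=\partial\Sigma$, and $\widetilde\Sigma$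 and $\Sigma$ define the same homology class in $H_2(U\times\mathbb R\mathbf v,\partial\Sigma;\mathbb Z)$. Then $\Sigma$ is a minimizer of $A_\phi$ in $\mathcal C$: $\Sigma\in\mathcal C$, and $A_\phi(\Sigma)\le A_\phi(\widetilde\Sigma)$ for every $\widetilde\Sigma\in\mathcal C$. (No condition on the weighted volume is imposed.) -/

import Mathlib

open Set MeasureTheory
open scoped Manifold ContDiff InnerProductSpace

noncomputable section

/-- Euclidean three-space. -/
abbrev E3 : Type := EuclideanSpace ℝ (Fin 3)

/-- The model of surfaces with (piecewise smooth) boundary: the quadrant `{x ≥ 0, y ≥ 0}` of the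
plane. Every smooth surface with smooth boundary is modelled on it, since the half plane is
covered by charts with values in the quadrant. -/
abbrev surfModel : ModelWithCorners ℝ (EuclideanSpace ℝ (Fin 2)) (EuclideanQuadrant 2) :=
  modelWithCornersEuclideanQuadrant 2

/-- The cross product of Euclidean three-space. -/
def cross (a b : E3) : E3 :=
  WithLp.toLp 2 (crossProduct (WithLp.ofLp a) (WithLp.ofLp b))

/-! ### Smooth cubical singular chains -/

/-- The closed unit cube of `ℝⁿ`. -/
def unitCube (n : ℕ) : Set (Fin n → ℝ) := Icc 0 1

/-- The open unit cube of `ℝⁿ`. -/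
def openCube (n : ℕ) : Set (Fin n → ℝ) := {t | ∀ k, 0 < t k ∧ t k < 1}

/-- A singular `n`-cube in `X`. -/
abbrev Cube (n : ℕ) (X : Type*) : Type _ := (Fin n → unitInterval) → X

/-- Cubical singular `n`-chains with integer coefficients: the free abelian group on `n`-cubes. -/
abbrev Chain (n : ℕ) (X : Type*) : Type _ := Cube n X →₀ ℤ

/-- The singular cube obtained by restricting a map on `ℝⁿ` to the unit cube. -/
def toCube {X : Type*} {n : ℕ} (g : (Fin n → ℝ) → X) : Cube n X :=
  fun t => g (fun k => (t k : ℝ))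

/-- The chain consisting of one cube, with coefficient one. -/
def cubeChain {X : Type*} {n : ℕ} (σ : Cube n X) : Chain n X := Finsupp.single σ 1

/-- The face of a cube on which the `i`-th coordinate equals `e`. -/
def face {X : Type*} {n : ℕ} (i : Fin (n + 1)) (e : unitInterval) (σ : Cube (n + 1) X) :
    Cube n X :=
  fun t => σ (i.insertNth e t)

/-- The boundary operator of cubical singular chains. -/
def bd {X : Type*} {n : ℕ} : Chain (n + 1) X →ₗ[ℤ] Chain n X :=
  Finsupp.linearCombination ℤ (fun σ : Cube (n + 1) X =>
    ∑ i : Fin (n + 1), ((-1 : ℤ) ^ (i : ℕ)) • (cubeChain (face i 1 σ) - cubeChain (face i 0 σ)))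

section smooth

variable {E H X : Type*} [NormedAddCommGroup E] [NormedSpace ℝ E] [TopologicalSpace H]
  [TopologicalSpace X] [ChartedSpace H X]

/-- A singular cube in the manifold `X` is smooth (up to the boundary of the cube). -/
def IsSmoothCube (I : ModelWithCorners ℝ E H) {n : ℕ} (σ : Cube n X) : Prop :=
  ∃ g : (Fin n → ℝ) → X, ContMDiffOn 𝓘(ℝ, Fin n → ℝ) I ∞ g (unitCube n) ∧ toCube g = σ

/-- The group of smooth `n`-chains of `X` supported in `A`. -/
def smoothChains (I : ModelWithCorners ℝ E H) (n : ℕ) (A : Set X) : Submodule ℤ (Chain n X) :=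
  Submodule.span ℤ {c | ∃ σ : Cube n X, IsSmoothCube I σ ∧ (∀ t, σ t ∈ A) ∧ c = cubeChain σ}

end smooth

/-- A cube is degenerate if it does not depend on one of its coordinates. -/
def IsDegenerateCube {X : Type*} {n : ℕ} (σ : Cube n X) : Prop :=
  ∃ i : Fin n, ∀ s t : Fin n → unitInterval, (∀ k, k ≠ i → s k = t k) → σ s = σ t

/-- The degenerate chains, which cubical homology divides out. -/
def degenerateChains (n : ℕ) (X : Type*) : Submodule ℤ (Chain n X) :=
  Submodule.span ℤ {c | ∃ σ : Cube n X, IsDegenerateCube σ ∧ c = cubeChain σ}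

/-- Two `2`-chains of `ℝ³` define the same class in the relative homology group
`H₂(A, B; ℤ)`, computed with smooth cubical singular chains: their difference is the boundary of a
`3`-chain in `A`, up to a chain in `B` and a degenerate chain. -/
def HomologousRel (A B : Set E3) (a b : Chain 2 E3) : Prop :=
  ∃ Ω ∈ smoothChains 𝓘(ℝ, E3) 3 A, ∃ γ ∈ smoothChains 𝓘(ℝ, E3) 2 B,
    ∃ δ ∈ degenerateChains 2 E3, a - b = bd Ω + γ + δ

/-! ### Compact oriented surfaces -/

/-- A compact oriented immersed surface with boundary in `ℝ³`: a compact two-dimensional manifold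
`M` with boundary (possibly with corners), an immersion `F` of `M` and a Gauss map `N`, that is, a
smooth unit normal field along `F`, which gives the orientation. -/
structure CompactSurface where
  M : Type
  [top : TopologicalSpace M]
  [charted : ChartedSpace (EuclideanQuadrant 2) M]
  [manifold : IsManifold surfModel ∞ M]
  [compact : CompactSpace M]
  [hausdorff : T2Space M]
  F : M → E3
  N : M → E3
  smooth_F : ContMDiff surfModel 𝓘(ℝ, E3) ∞ F
  immersion : ∀ p : M, Function.Injective (mfderiv surfModel 𝓘(ℝ, E3) F p)
  smooth_N : ContMDiff surfModel 𝓘(ℝ, E3) ∞ N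
  unit_N : ∀ p : M, ‖N p‖ = 1
  normal_N : ∀ (p : M) (w : TangentSpace surfModel p),
    inner ℝ (N p) (show E3 from mfderiv surfModel 𝓘(ℝ, E3) F p w) = 0

namespace CompactSurface

attribute [instance] CompactSurface.top CompactSurface.charted CompactSurface.manifold
  CompactSurface.compact CompactSurface.hausdorff

/-- The boundary curve(s) of the surface, as a subset of `ℝ³`. -/
def bdry (S : CompactSurface) : Set E3 := S.F '' surfModel.boundary S.M

/-- `h` is the mean curvature of `S` at `p` (the sum of the principal curvatures): the trace of the
shape operator `A : T_pM → T_pM`, which is given by `dF ∘ A = -dN`. -/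
def HasMeanCurvatureAt (S : CompactSurface) (p : S.M) (h : ℝ) : Prop :=
  ∃ A : TangentSpace surfModel p →ₗ[ℝ] TangentSpace surfModel p,
    (∀ w, (show E3 from mfderiv surfModel 𝓘(ℝ, E3) S.F p (A w)) =
      -(show E3 from mfderiv surfModel 𝓘(ℝ, E3) S.N p w)) ∧
    LinearMap.trace ℝ (TangentSpace surfModel p) A = h

/-- Translating `lam`-solitons with density vector `v`: `H = ⟨N, v⟩ + lam`. -/
def IsTranslatingSoliton (S : CompactSurface) (v : E3) (lam : ℝ) : Prop :=
  ∀ p : S.M, S.HasMeanCurvatureAt p (inner ℝ (S.N p) v + lam)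

/-- `S` is (embedded as) the graph of a smooth function `u` on the subset `U` of the plane
orthogonal to `v`. -/
def IsGraphOver (S : CompactSurface) (v : E3) (U : Set (ℝ ∙ v)ᗮ) : Prop :=
  Function.Injective S.F ∧
    ∃ u : (ℝ ∙ v)ᗮ → ℝ, ContDiffOn ℝ ∞ u U ∧ range S.F = {y | ∃ x ∈ U, y = (x : E3) + u x • v}

/-- A subdivision of the surface `S` into finitely many smooth, positively oriented square cells,
which do not overlap and whose common edges cancel, so that their sum is a chain that represents
the fundamental class of `S` in `H₂(M, ∂M; ℤ)`. Every compact oriented surface has one. -/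
structure Subdivision (S : CompactSurface) where
  num : ℕ
  cell : Fin num → (Fin 2 → ℝ) → S.M
  smooth : ∀ i, ContMDiffOn 𝓘(ℝ, Fin 2 → ℝ) surfModel ∞ (cell i) (unitCube 2)
  disjoint : ∀ i j, ∀ s ∈ openCube 2, ∀ t ∈ openCube 2, cell i s = cell j t → i = j ∧ s = t
  cover : ∀ p : S.M, ∃ i, ∃ t ∈ unitCube 2, cell i t = p
  oriented : ∀ i, ∀ t ∈ openCube 2,
    0 < inner ℝ (S.N (cell i t))
      (cross (fderivWithin ℝ (S.F ∘ cell i) (unitCube 2) t (Pi.single 0 1))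
        (fderivWithin ℝ (S.F ∘ cell i) (unitCube 2) t (Pi.single 1 1)))
  bd_mem : bd (∑ i, cubeChain (toCube (cell i))) ∈
    smoothChains surfModel 1 (surfModel.boundary S.M) ⊔ degenerateChains 1 S.M

namespace Subdivision

/-- The image in `ℝ³` of the fundamental chain of the surface. -/
def chain {S : CompactSurface} (K : S.Subdivision) : Chain 2 E3 :=
  ∑ i, cubeChain (toCube (S.F ∘ K.cell i))

/-- The weighted area `∫ e^φ dA`, with `φ(x) = ⟨x, v⟩`, computed in the parametrizations of the
cells, where `dA = |∂₁f × ∂₂f| ds dt`. (It does not depend on the subdivision.) -/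
def weightedArea {S : CompactSurface} (K : S.Subdivision) (v : E3) : ℝ :=
  ∑ i, ∫ t in unitCube 2, Real.exp (inner ℝ (S.F (K.cell i t)) v) *
    ‖cross (fderivWithin ℝ (S.F ∘ K.cell i) (unitCube 2) t (Pi.single 0 1))
      (fderivWithin ℝ (S.F ∘ K.cell i) (unitCube 2) t (Pi.single 1 1))‖

end Subdivision

end CompactSurface

/-- The solid cylinder `U × ℝv`. -/
def cylinder (v : E3) (U : Set (ℝ ∙ v)ᗮ) : Set E3 := {y | ∃ x ∈ U, ∃ t : ℝ, y = (x : E3) + t • v}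

/-- The surface `T` is included in the cylinder `U × ℝv` and has the same boundary and the same
homology class (in the cylinder, relative to the common boundary) as `S`. -/
def InClass (v : E3) (U : Set (ℝ ∙ v)ᗮ) {S T : CompactSurface} (K : S.Subdivision)
    (L : T.Subdivision) : Prop :=
  range T.F ⊆ cylinder v U ∧ T.bdry = S.bdry ∧
    HomologousRel (cylinder v U) S.bdry L.chain K.chain

end

/-! ### The cross product -/

/-! The proof is by calibration. Let `X` be the Gauss map of the graph, extended to the cylinder by
translations along `v` (`extendedNormal`). Its differential is `dN` composed with the inverse of the
projected differential of `F` and with the projection, and has trace `-H`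
(`IsGraphOver.exists_trace`). Hence `div (e^φ X) = e^φ (div X + ⟨X, v⟩) = e^φ (-H + ⟨N, v⟩) = 0` by
the soliton equation, so the flux form of `e^φ X` is closed.

A competitor differs from the graph by `bd Ω + γ + δ`. The flux through `bd Ω` vanishes by Stokes'
theorem (`fluxChain_bd_eq_zero`). It vanishes on `γ`, since the boundary is too small to contain a
square of rank two (`fluxChain_eq_zero_of_null`, `volume_image_bdry`), and on `δ` by degeneracy.
Thus both surfaces have the same flux. For the graph it is the weighted area, because `X = N` there;
for the competitor it is at most the weighted area, because `|X| ≤ 1`.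

The set `U` need not be open, so `X` itself is never differentiated: Stokes' theorem uses only its
pullbacks `X ∘ g` by smooth cubes of the cylinder, continuous up to the boundary and differentiable
inside (`IsGraphOver.extendedNormal_comp`). -/

lemma cross_apply_zero (a b : E3) : cross a b 0 = a 1 * b 2 - a 2 * b 1 := by
  simp [cross, cross_apply]

lemma cross_apply_one (a b : E3) : cross a b 1 = a 2 * b 0 - a 0 * b 2 := by
  simp [cross, cross_apply]

lemma cross_apply_two (a b : E3) : cross a b 2 = a 0 * b 1 - a 1 * b 0 := by
  simp [cross, cross_apply]

lemma inner_eq_sum_three (x y : E3) : inner ℝ x y = x 0 * y 0 + x 1 * y 1 + x 2 * y 2 := by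
  simp [PiLp.inner_apply, Fin.sum_univ_three, mul_comm]

/-- The cross product as a continuous bilinear map. -/
noncomputable def crossL : E3 →L[ℝ] E3 →L[ℝ] E3 :=
  (LinearMap.mk₂ ℝ cross
    (fun a b c => by ext i; fin_cases i <;> simp [cross, cross_apply])
    (fun r a b => by ext i; fin_cases i <;> simp [cross, cross_apply])
    (fun a b c => by ext i; fin_cases i <;> simp [cross, cross_apply] <;> ring)
    (fun r a b => by ext i; fin_cases i <;> simp [cross, cross_apply])).toContinuousBilinearMap

lemma crossL_apply (a b : E3) : crossL a b = cross a b := rfl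

lemma cross_zero_left (a : E3) : cross 0 a = 0 := by
  rw [← crossL_apply]; simp

lemma cross_zero_right (a : E3) : cross a 0 = 0 := by
  rw [← crossL_apply]; simp

lemma HasFDerivAt.cross {E : Type*} [NormedAddCommGroup E] [NormedSpace ℝ E] {f g : E → E3}
    {f' g' : E →L[ℝ] E3} {t : E} (hf : HasFDerivAt f f' t) (hg : HasFDerivAt g g' t) :
    HasFDerivAt (fun s => cross (f s) (g s))
      (crossL.precompR E (f t) g' + crossL.precompL E f' (g t)) t :=
  crossL.hasFDerivAt_of_bilinear hf hg

/-- Lagrange's identity for a unit vector orthogonal to both factors. -/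
lemma inner_cross_eq_norm {n a b : E3} (hn : ‖n‖ = 1) (ha : inner ℝ n a = 0)
    (hb : inner ℝ n b = 0) (hpos : 0 ≤ inner ℝ n (cross a b)) :
    inner ℝ n (cross a b) = ‖cross a b‖ := by
  have hn' : n 0 * n 0 + n 1 * n 1 + n 2 * n 2 = 1 := by
    rw [← inner_eq_sum_three, real_inner_self_eq_norm_sq, hn]; norm_num
  have hsq : (inner ℝ n (cross a b)) ^ 2 = ‖cross a b‖ ^ 2 := by
    rw [← real_inner_self_eq_norm_sq]
    simp only [inner_eq_sum_three, cross_apply_zero, cross_apply_one, cross_apply_two] at *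
    -- The components of `n × (a × b) = ⟨n, b⟩ a - ⟨n, a⟩ b = 0`. The conclusion is then `|n|² |c|²
    -- = ⟨n, c⟩² + |n × c|²` for `c = a × b`.
    have e0 : n 1 * (a 0 * b 1 - a 1 * b 0) - n 2 * (a 2 * b 0 - a 0 * b 2) = 0 := by
      linear_combination a 0 * hb - b 0 * ha
    have e1 : n 2 * (a 1 * b 2 - a 2 * b 1) - n 0 * (a 0 * b 1 - a 1 * b 0) = 0 := by
      linear_combination a 1 * hb - b 1 * ha
    have e2 : n 0 * (a 2 * b 0 - a 0 * b 2) - n 1 * (a 1 * b 2 - a 2 * b 1) = 0 := by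
      linear_combination a 2 * hb - b 2 * ha
    generalize a 0 * b 1 - a 1 * b 0 = c2 at *
    generalize a 2 * b 0 - a 0 * b 2 = c1 at *
    generalize a 1 * b 2 - a 2 * b 1 = c0 at *
    linear_combination (c0 * c0 + c1 * c1 + c2 * c2) * hn' - (n 1 * c2 - n 2 * c1) * e0 -
      (n 2 * c0 - n 0 * c2) * e1 - (n 0 * c1 - n 1 * c0) * e2
  exact (sq_eq_sq₀ hpos (norm_nonneg _)).1 hsq

/-- The trace of an endomorphism of `ℝ³` through the mixed products. -/
lemma trace_mul_mixedProduct (B : E3 →L[ℝ] E3) (a b c : E3) :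
    inner ℝ (B a) (cross b c) - inner ℝ (B b) (cross a c) + inner ℝ (B c) (cross a b) =
      LinearMap.trace ℝ E3 B * inner ℝ a (cross b c) := by
  have hB : ∀ (x : E3) (i : Fin 3), B x i =
      x 0 * B (EuclideanSpace.single 0 1) i + x 1 * B (EuclideanSpace.single 1 1) i +
        x 2 * B (EuclideanSpace.single 2 1) i := by
    intro x i
    have hx : x = x 0 • EuclideanSpace.single 0 (1 : ℝ) + x 1 • EuclideanSpace.single 1 (1 : ℝ) +
        x 2 • EuclideanSpace.single 2 (1 : ℝ) := by
      ext j; fin_cases j <;> simp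
    conv_lhs => rw [hx]
    simp
  have htr : LinearMap.trace ℝ E3 B = B (EuclideanSpace.single 0 1) 0 +
      B (EuclideanSpace.single 1 1) 1 + B (EuclideanSpace.single 2 1) 2 := by
    rw [LinearMap.trace_eq_matrix_trace ℝ (EuclideanSpace.basisFun (Fin 3) ℝ).toBasis]
    simp [Matrix.trace, Fin.sum_univ_three, LinearMap.toMatrix_apply]
  simp only [inner_eq_sum_three, cross_apply_zero, cross_apply_one, cross_apply_two, htr, hB a,
    hB b, hB c]
  ring

/-- The expansion of `⟨n, v⟩ det(a, b, c)` along the mixed products with `n`. -/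
lemma mixedProduct_cyclic (v n a b c : E3) :
    inner ℝ a v * inner ℝ n (cross b c) - inner ℝ b v * inner ℝ n (cross a c) +
      inner ℝ c v * inner ℝ n (cross a b) = inner ℝ n v * inner ℝ a (cross b c) := by
  simp only [inner_eq_sum_three, cross_apply_zero, cross_apply_one, cross_apply_two]
  ring

lemma cross_swap (a b : E3) : cross a b = -cross b a := by
  ext i; fin_cases i <;> simp [cross, cross_apply] <;> ring

/-! ### Cubes -/

lemma openCube_eq_pi (n : ℕ) : openCube n = pi univ fun _ => Ioo (0 : ℝ) 1 := by
  ext t; simp [openCube]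

lemma isOpen_openCube (n : ℕ) : IsOpen (openCube n) := by
  rw [openCube_eq_pi]
  exact isOpen_set_pi finite_univ fun _ _ => isOpen_Ioo

lemma openCube_subset (n : ℕ) : openCube n ⊆ unitCube n := fun _ ht =>
  ⟨fun k => (ht k).1.le, fun k => (ht k).2.le⟩

lemma unitCube_mem_nhds {n : ℕ} {t : Fin n → ℝ} (ht : t ∈ openCube n) : unitCube n ∈ nhds t :=
  Filter.mem_of_superset ((isOpen_openCube n).mem_nhds ht) (openCube_subset n)

lemma openCube_ae_eq (n : ℕ) : openCube n =ᵐ[volume] unitCube n := by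
  rw [openCube_eq_pi]
  exact Measure.univ_pi_Ioo_ae_eq_Icc

lemma uniqueDiffOn_unitCube (n : ℕ) : UniqueDiffOn ℝ (unitCube n) := by
  rw [unitCube, ← pi_univ_Icc]
  exact UniqueDiffOn.univ_pi fun _ => uniqueDiffOn_Icc one_pos

lemma isCompact_unitCube (n : ℕ) : IsCompact (unitCube n) := isCompact_Icc

lemma measurableSet_unitCube (n : ℕ) : MeasurableSet (unitCube n) := measurableSet_Icc

/-- The extension of a singular cube by the projection to the unit cube. -/
noncomputable def cubeExt {X : Type*} {n : ℕ} (σ : Cube n X) (t : Fin n → ℝ) : X :=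
  σ fun k => projIcc 0 1 zero_le_one (t k)

lemma cubeExt_toCube {X : Type*} {n : ℕ} (g : (Fin n → ℝ) → X) :
    EqOn (cubeExt (toCube g)) g (unitCube n) := by
  intro t ht
  have : (fun k => ((projIcc 0 1 zero_le_one (t k) : unitInterval) : ℝ)) = t := by
    ext k
    rw [projIcc_of_mem zero_le_one ⟨ht.1 k, ht.2 k⟩]
  simp only [cubeExt, toCube, this]

/-! ### The flux form -/

/-- The density of the flux form `e^{⟨x, v⟩} i_X dV` pulled back by `f`, where `Y = X ∘ f`. -/
noncomputable def fluxDensity (v : E3) (f Y : (Fin 2 → ℝ) → E3) (t : Fin 2 → ℝ) : ℝ :=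
  Real.exp (inner ℝ (f t) v) *
    inner ℝ (Y t) (cross (fderivWithin ℝ f (unitCube 2) t (Pi.single 0 1))
      (fderivWithin ℝ f (unitCube 2) t (Pi.single 1 1)))

/-- The integral of the flux form of the vector field `X` over a singular square. -/
noncomputable def flux (v : E3) (X : E3 → E3) (σ : Cube 2 E3) : ℝ :=
  ∫ t in unitCube 2, fluxDensity v (cubeExt σ) (X ∘ cubeExt σ) t

/-- The integral of the flux form over chains. -/
noncomputable def fluxChain (v : E3) (X : E3 → E3) : Chain 2 E3 →ₗ[ℤ] ℝ :=
  Finsupp.linearCombination ℤ (flux v X)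

lemma fluxChain_cubeChain (v : E3) (X : E3 → E3) (σ : Cube 2 E3) :
    fluxChain v X (cubeChain σ) = flux v X σ := by
  simp [fluxChain, cubeChain]

/-- Derivatives are taken within the cube, so the flux does not see how the square is extended
beyond it. -/
lemma flux_toCube (v : E3) (X : E3 → E3) (g : (Fin 2 → ℝ) → E3) :
    flux v X (toCube g) = ∫ t in unitCube 2, fluxDensity v g (X ∘ g) t := by
  refine setIntegral_congr_fun (measurableSet_unitCube 2) fun t ht => ?_
  have h := cubeExt_toCube g
  simp only [fluxDensity, Function.comp, h ht, fderivWithin_congr h (h ht)]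

lemma flux_eq_zero_of_isDegenerateCube (v : E3) (X : E3 → E3) {σ : Cube 2 E3}
    (hσ : IsDegenerateCube σ) : flux v X σ = 0 := by
  obtain ⟨i, hi⟩ := hσ
  have key : ∀ t ∈ unitCube 2,
      fderivWithin ℝ (cubeExt σ) (unitCube 2) t (Pi.single i 1) = 0 := by
    intro t ht
    by_cases hd : DifferentiableWithinAt ℝ (cubeExt σ) (unitCube 2) t
    -- The map `q` freezes the `i`-th coordinate at `t i` and leaves the cube unchanged, so the
    -- derivative factors through `P`, which kills the `i`-th direction.
    · set P : (Fin 2 → ℝ) →L[ℝ] (Fin 2 → ℝ) :=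
        ContinuousLinearMap.pi fun k => if k = i then 0 else ContinuousLinearMap.proj k with hP
      have hPi : P (Pi.single i 1) = 0 := by
        ext k
        by_cases hk : k = i <;> simp [hP, hk]
      set q : (Fin 2 → ℝ) → (Fin 2 → ℝ) := fun s => P (s - t) + t with hq
      have hqt : q t = t := by simp [hq]
      have hqk : ∀ s k, k ≠ i → q s k = s k := by intro s k hk; simp [hq, hP, hk]
      have hqi : ∀ s, q s i = t i := by intro s; simp [hq, hP]
      have hmap : MapsTo q (unitCube 2) (unitCube 2) := by
        intro s hs
        have : ∀ k, 0 ≤ q s k ∧ q s k ≤ 1 := by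
          intro k
          by_cases hk : k = i
          · subst hk; rw [hqi]; exact ⟨ht.1 k, ht.2 k⟩
          · rw [hqk s k hk]; exact ⟨hs.1 k, hs.2 k⟩
        exact ⟨fun k => (this k).1, fun k => (this k).2⟩
      have hcomp : cubeExt σ ∘ q = cubeExt σ := by
        funext s
        exact hi _ _ fun k hk => by simp only [hqk s k hk]
      have hqd : HasFDerivWithinAt q P (unitCube 2) t := by
        have := (P.hasFDerivAt.comp t ((hasFDerivAt_id t).sub_const t)).add_const t
        exact this.hasFDerivWithinAt
      have h1 := (hqt.symm ▸ hd.hasFDerivWithinAt :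
        HasFDerivWithinAt (cubeExt σ) (fderivWithin ℝ (cubeExt σ) (unitCube 2) t) (unitCube 2)
          (q t)).comp t hqd hmap
      rw [hcomp] at h1
      rw [h1.fderivWithin (uniqueDiffOn_unitCube 2 t ht)]
      simp [hPi]
    -- Degenerate cubes need not be smooth; at bad points the default derivative is zero.
    · rw [fderivWithin_zero_of_not_differentiableWithinAt hd]; rfl
  refine setIntegral_eq_zero_of_forall_eq_zero fun t ht => ?_
  have h := key t ht
  fin_cases i
  · simp only [Fin.zero_eta, Fin.isValue] at h
    simp [fluxDensity, h, cross_zero_left]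
  · simp only [Fin.mk_one, Fin.isValue] at h
    simp [fluxDensity, h, cross_zero_right]

lemma fluxChain_eq_zero_of_mem_degenerateChains (v : E3) (X : E3 → E3) {δ : Chain 2 E3}
    (hδ : δ ∈ degenerateChains 2 E3) : fluxChain v X δ = 0 := by
  have : degenerateChains 2 E3 ≤ LinearMap.ker (fluxChain v X) := by
    refine Submodule.span_le.2 ?_
    rintro _ ⟨σ, hσ, rfl⟩
    simpa [fluxChain_cubeChain] using flux_eq_zero_of_isDegenerateCube v X hσ
  exact this hδ

/-- If the images of the basis of the plane have a nonzero cross product, then some linear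
projection of the map is onto the plane. -/
lemma surjective_of_cross_ne_zero (D : (Fin 2 → ℝ) →L[ℝ] E3)
    (h : cross (D (Pi.single 0 1)) (D (Pi.single 1 1)) ≠ 0) :
    ∃ P : E3 →L[ℝ] (Fin 2 → ℝ), Function.Surjective (P ∘L D) := by
  set a := D (Pi.single 0 1) with ha
  set b := D (Pi.single 1 1) with hb
  -- Pairing with `a` and `b` is injective on their span, since a vector of the span orthogonal to
  -- both is orthogonal to itself.
  refine ⟨ContinuousLinearMap.pi ![innerSL ℝ a, innerSL ℝ b], ?_⟩
  apply (LinearMap.injective_iff_surjective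
    (f := ((ContinuousLinearMap.pi ![innerSL ℝ a, innerSL ℝ b] ∘L D : (Fin 2 → ℝ) →L[ℝ] _) :
      (Fin 2 → ℝ) →ₗ[ℝ] (Fin 2 → ℝ)))).1
  refine (injective_iff_map_eq_zero _).2 fun s hs => ?_
  have hs' : s = s 0 • Pi.single 0 1 + s 1 • Pi.single 1 1 := by
    ext k; fin_cases k <;> simp
  have hD : D s = s 0 • a + s 1 • b := by
    conv_lhs => rw [hs']
    simp [ha, hb]
  have h0 : inner ℝ a (D s) = 0 := by simpa using congrFun hs 0
  have h1 : inner ℝ b (D s) = 0 := by simpa using congrFun hs 1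
  have hDs : D s = 0 := by
    rw [← inner_self_eq_zero (𝕜 := ℝ)]
    conv_lhs => rw [hD]
    rw [inner_add_left, inner_smul_left, inner_smul_left, ← hD, h0, h1]
    simp
  rw [hD] at hDs
  have e0 : cross (s 0 • a + s 1 • b) b = s 0 • cross a b := by
    ext i; fin_cases i <;> simp [cross, cross_apply]
  have e1 : cross a (s 0 • a + s 1 • b) = s 1 • cross a b := by
    ext i; fin_cases i <;> simp [cross, cross_apply] <;> ring
  rw [hDs, cross_zero_left, eq_comm, smul_eq_zero] at e0
  rw [hDs, cross_zero_right, eq_comm, smul_eq_zero] at e1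
  ext k; fin_cases k
  · simpa using e0.resolve_right h
  · simpa using e1.resolve_right h

/-- The flux through a smooth square vanishes if the square stays in a set all of whose linear
images in the plane are null sets. -/
lemma flux_eq_zero_of_null (v : E3) (X : E3 → E3) {A : Set E3}
    (hA : ∀ P : E3 →L[ℝ] (Fin 2 → ℝ), volume (P '' A) = 0) {g : (Fin 2 → ℝ) → E3}
    (hg : ContDiffOn ℝ ∞ g (unitCube 2)) (hgA : MapsTo g (unitCube 2) A) :
    flux v X (toCube g) = 0 := by
  rw [flux_toCube, ← setIntegral_congr_set (openCube_ae_eq 2)]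
  refine setIntegral_eq_zero_of_forall_eq_zero fun t ht => ?_
  have hgt : ContDiffAt ℝ ∞ g t :=
    (hg t (openCube_subset 2 ht)).contDiffAt (unitCube_mem_nhds ht)
  -- A nonzero density makes `P ∘ g` a submersion at `t` for some `P`; then `P '' A` contains a
  -- neighbourhood and cannot be null.
  by_contra hne
  rw [fluxDensity, fderivWithin_of_mem_nhds (unitCube_mem_nhds ht)] at hne
  obtain ⟨P, hP⟩ := surjective_of_cross_ne_zero (fderiv ℝ g t) fun h => hne (by simp [h])
  have hstrict : HasStrictFDerivAt (P ∘ g) (P ∘L fderiv ℝ g t) t :=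
    P.hasStrictFDerivAt.comp t (hgt.hasStrictFDerivAt (by simp))
  have hmap := hstrict.map_nhds_eq_of_surj (LinearMap.range_eq_top.2 hP)
  have hmem : P '' A ∈ nhds (P (g t)) := by
    change P '' A ∈ nhds ((P ∘ g) t)
    rw [← hmap, Filter.mem_map]
    exact Filter.mem_of_superset (unitCube_mem_nhds ht) fun s hs => ⟨g s, hgA hs, rfl⟩
  exact (Measure.measure_pos_of_mem_nhds volume hmem).ne' (hA P)

lemma fluxChain_eq_zero_of_null (v : E3) (X : E3 → E3) {A : Set E3}
    (hA : ∀ P : E3 →L[ℝ] (Fin 2 → ℝ), volume (P '' A) = 0) {γ : Chain 2 E3}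
    (hγ : γ ∈ smoothChains 𝓘(ℝ, E3) 2 A) : fluxChain v X γ = 0 := by
  have : smoothChains 𝓘(ℝ, E3) 2 A ≤ LinearMap.ker (fluxChain v X) := by
    refine Submodule.span_le.2 ?_
    rintro _ ⟨_, ⟨g, hg, rfl⟩, hA', rfl⟩
    have hgA : MapsTo g (unitCube 2) A := by
      intro t ht
      rw [← cubeExt_toCube g ht]
      exact hA' _
    simpa [fluxChain_cubeChain] using
      flux_eq_zero_of_null v X hA (contMDiffOn_iff_contDiffOn.1 hg) hgA
  exact this hγ

/-! ### Stokes' theorem on the cube -/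

/-- The coefficient, without sign, of the pulled back flux form at the `i`-th faces of a cube. -/
noncomputable def faceDensity (v : E3) (g Y : (Fin 3 → ℝ) → E3) (i : Fin 3) (t : Fin 3 → ℝ) : ℝ :=
  Real.exp (inner ℝ (g t) v) *
    inner ℝ (Y t) (cross (fderivWithin ℝ g (unitCube 3) t (Pi.single (i.succAbove 0) 1))
      (fderivWithin ℝ g (unitCube 3) t (Pi.single (i.succAbove 1) 1)))

lemma insertNth_mem_unitCube {n : ℕ} (i : Fin (n + 1)) {e : ℝ} (he : e ∈ Icc (0 : ℝ) 1)
    {t : Fin n → ℝ} (ht : t ∈ unitCube n) :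
    i.insertNth (α := fun _ => ℝ) e t ∈ unitCube (n + 1) := by
  constructor
  · intro k
    rcases Fin.eq_self_or_eq_succAbove i k with rfl | ⟨j, rfl⟩
    · simpa using he.1
    · simpa using ht.1 j
  · intro k
    rcases Fin.eq_self_or_eq_succAbove i k with rfl | ⟨j, rfl⟩
    · simpa using he.2
    · simpa using ht.2 j

lemma face_toCube {X : Type*} {n : ℕ} (i : Fin (n + 1)) (e : unitInterval)
    (g : (Fin (n + 1) → ℝ) → X) :
    face i e (toCube g) = toCube fun t => g (i.insertNth (α := fun _ => ℝ) (e : ℝ) t) := by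
  funext t
  simp only [face, toCube]
  congr 1
  funext k
  rcases Fin.eq_self_or_eq_succAbove i k with rfl | ⟨j, rfl⟩ <;> simp

lemma hasFDerivAt_insertNth {n : ℕ} (i : Fin (n + 1)) (e : ℝ) (t : Fin n → ℝ) :
    ∃ J : (Fin n → ℝ) →L[ℝ] (Fin (n + 1) → ℝ),
      HasFDerivAt (fun s : Fin n → ℝ => i.insertNth (α := fun _ => ℝ) e s) J t ∧
        ∀ k, J (Pi.single k 1) = Pi.single (i.succAbove k) 1 := by
  refine ⟨ContinuousLinearMap.pi fun j => i.insertNth (α := fun _ => (Fin n → ℝ) →L[ℝ] ℝ) 0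
    (fun k => ContinuousLinearMap.proj k) j, ?_, ?_⟩
  · refine hasFDerivAt_pi.2 fun j => ?_
    rcases Fin.eq_self_or_eq_succAbove i j with rfl | ⟨j, rfl⟩
    · simpa using hasFDerivAt_const e t
    · simpa using hasFDerivAt_apply j t
  · intro k
    ext j
    rcases Fin.eq_self_or_eq_succAbove i j with rfl | ⟨j, rfl⟩
    · simp
    · by_cases h : j = k
      · subst h; simp
      · simp [h]

lemma flux_face_toCube (v : E3) (X : E3 → E3) {g : (Fin 3 → ℝ) → E3}
    (hg : ContDiffOn ℝ ∞ g (unitCube 3)) (i : Fin 3) (e : unitInterval) :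
    flux v X (face i e (toCube g)) =
      ∫ t in unitCube 2, faceDensity v g (X ∘ g) i (i.insertNth (α := fun _ => ℝ) (e : ℝ) t) := by
  rw [face_toCube, flux_toCube]
  refine setIntegral_congr_fun (measurableSet_unitCube 2) fun t ht => ?_
  obtain ⟨J, hJ, hJk⟩ := hasFDerivAt_insertNth i (e : ℝ) t
  have hmem := insertNth_mem_unitCube i e.2 ht
  have hd : HasFDerivWithinAt g (fderivWithin ℝ g (unitCube 3)
      (i.insertNth (α := fun _ => ℝ) (e : ℝ) t)) (unitCube 3)
      (i.insertNth (α := fun _ => ℝ) (e : ℝ) t) :=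
    (hg.differentiableOn (by simp) _ hmem).hasFDerivWithinAt
  have hc := hd.comp t hJ.hasFDerivWithinAt fun s hs => insertNth_mem_unitCube i e.2 hs
  have hc' := hc.fderivWithin (uniqueDiffOn_unitCube 2 t ht)
  simp only [Function.comp_def] at hc'
  simp only [fluxDensity, faceDensity, hc', ContinuousLinearMap.comp_apply, hJk, Function.comp]

lemma continuousOn_faceDensity (v : E3) {g Y : (Fin 3 → ℝ) → E3}
    (hg : ContDiffOn ℝ ∞ g (unitCube 3)) (hY : ContinuousOn Y (unitCube 3)) (i : Fin 3) :
    ContinuousOn (faceDensity v g Y i) (unitCube 3) := by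
  have hD : ContinuousOn (fderivWithin ℝ g (unitCube 3)) (unitCube 3) :=
    hg.continuousOn_fderivWithin (uniqueDiffOn_unitCube 3) (by simp)
  have hg' := hg.continuousOn
  have hcr : Continuous fun p : E3 × E3 => cross p.1 p.2 :=
    (crossL.continuous.comp continuous_fst).clm_apply continuous_snd
  refine ContinuousOn.mul ?_ ?_
  · exact Real.continuous_exp.comp_continuousOn (hg'.inner continuousOn_const)
  · exact hY.inner (hcr.comp_continuousOn
      ((hD.clm_apply continuousOn_const).prodMk (hD.clm_apply continuousOn_const)))

/-- The product rule: one term from the weight, one from the field, and two with second derivatives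
of `g`, which cancel in the alternating sum over the faces. -/
lemma hasFDerivAt_faceDensity (v : E3) {g Y : (Fin 3 → ℝ) → E3}
    (hg : ContDiffOn ℝ ∞ g (unitCube 3)) {t : Fin 3 → ℝ} (ht : t ∈ openCube 3)
    {Y' : (Fin 3 → ℝ) →L[ℝ] E3} (hY : HasFDerivAt Y Y' t) (i : Fin 3) :
    ∃ f' : (Fin 3 → ℝ) →L[ℝ] ℝ, HasFDerivAt (faceDensity v g Y i) f' t ∧
      ∀ w, f' w = Real.exp (inner ℝ (g t) v) *
        (inner ℝ (fderiv ℝ g t w) v * inner ℝ (Y t)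
          (cross (fderiv ℝ g t (Pi.single (i.succAbove 0) 1))
            (fderiv ℝ g t (Pi.single (i.succAbove 1) 1))) +
        inner ℝ (Y' w) (cross (fderiv ℝ g t (Pi.single (i.succAbove 0) 1))
            (fderiv ℝ g t (Pi.single (i.succAbove 1) 1))) +
        inner ℝ (Y t) (cross (fderiv ℝ (fderiv ℝ g) t w (Pi.single (i.succAbove 0) 1))
            (fderiv ℝ g t (Pi.single (i.succAbove 1) 1))) +
        inner ℝ (Y t) (cross (fderiv ℝ g t (Pi.single (i.succAbove 0) 1))
            (fderiv ℝ (fderiv ℝ g) t w (Pi.single (i.succAbove 1) 1)))) := by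
  have hgt : ContDiffAt ℝ ∞ g t :=
    (hg t (openCube_subset 3 ht)).contDiffAt (unitCube_mem_nhds ht)
  have hg1 : HasFDerivAt g (fderiv ℝ g t) t := (hgt.differentiableAt (by simp)).hasFDerivAt
  have hg2 : HasFDerivAt (fderiv ℝ g) (fderiv ℝ (fderiv ℝ g) t) t :=
    ((hgt.fderiv_right (m := 1) (by norm_cast)).differentiableAt (by simp)).hasFDerivAt
  have ha : ∀ w : Fin 3 → ℝ, HasFDerivAt (fun s => fderiv ℝ g s w)
      ((fderiv ℝ (fderiv ℝ g) t).flip w) t := by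
    intro w
    exact ((ContinuousLinearMap.apply ℝ E3 w).hasFDerivAt).comp t hg2
  have hev : faceDensity v g Y i =ᶠ[nhds t] fun s => Real.exp (inner ℝ (g s) v) *
      inner ℝ (Y s) (cross (fderiv ℝ g s (Pi.single (i.succAbove 0) 1))
        (fderiv ℝ g s (Pi.single (i.succAbove 1) 1))) := by
    filter_upwards [(isOpen_openCube 3).mem_nhds ht] with s hs
    rw [faceDensity, fderivWithin_of_mem_nhds (unitCube_mem_nhds hs)]
  have h := ((hg1.inner ℝ (hasFDerivAt_const v t)).exp).mul
    (hY.inner ℝ ((ha (Pi.single (i.succAbove 0) 1)).cross (ha (Pi.single (i.succAbove 1) 1))))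
  refine ⟨_, h.congr_of_eventuallyEq hev, fun w => ?_⟩
  simp [fderivInnerCLM_apply, inner_add_right, crossL_apply]
  ring

/-- The flux form of a vector field of vanishing weighted divergence is closed. -/
lemma sum_faceDensity_deriv_eq_zero (v : E3) {g Y : (Fin 3 → ℝ) → E3}
    (hg : ContDiffOn ℝ ∞ g (unitCube 3)) {t : Fin 3 → ℝ} (ht : t ∈ openCube 3) {B : E3 →L[ℝ] E3}
    (hB : LinearMap.trace ℝ E3 B = -inner ℝ (Y t) v)
    (hY : HasFDerivAt Y (B ∘L fderiv ℝ g t) t) :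
    ∑ i : Fin 3, (-1 : ℝ) ^ (i : ℕ) * fderiv ℝ (faceDensity v g Y i) t (Pi.single i 1) = 0 := by
  have hgt : ContDiffAt ℝ ∞ g t :=
    (hg t (openCube_subset 3 ht)).contDiffAt (unitCube_mem_nhds ht)
  have hsymm : IsSymmSndFDerivAt ℝ g t := hgt.isSymmSndFDerivAt (by simp; norm_cast)
  have key : ∀ i, _ := fun i => hasFDerivAt_faceDensity v hg ht hY i
  choose f' hf' hf using key
  have s00 : (0 : Fin 3).succAbove (0 : Fin 2) = 1 := rfl
  have s01 : (0 : Fin 3).succAbove (1 : Fin 2) = 2 := rfl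
  have s10 : (1 : Fin 3).succAbove (0 : Fin 2) = 0 := rfl
  have s11 : (1 : Fin 3).succAbove (1 : Fin 2) = 2 := rfl
  have s20 : (2 : Fin 3).succAbove (0 : Fin 2) = 0 := rfl
  have s21 : (2 : Fin 3).succAbove (1 : Fin 2) = 1 := rfl
  simp only [Fin.sum_univ_three, (hf' _).fderiv, hf, s00, s01, s10, s11, s20, s21,
    ContinuousLinearMap.comp_apply]
  -- `h1` collects the terms with the divergence of the field, `h2` those with the derivative of the
  -- weight; by `hB` they are opposite.
  have h1 := trace_mul_mixedProduct B (fderiv ℝ g t (Pi.single 0 1)) (fderiv ℝ g t (Pi.single 1 1))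
    (fderiv ℝ g t (Pi.single 2 1))
  have h2 := mixedProduct_cyclic v (Y t) (fderiv ℝ g t (Pi.single 0 1))
    (fderiv ℝ g t (Pi.single 1 1)) (fderiv ℝ g t (Pi.single 2 1))
  rw [hB] at h1
  -- Symmetry of the second derivative against antisymmetry of the cross product removes the
  -- second-order terms.
  rw [hsymm (Pi.single 1 1) (Pi.single 0 1), hsymm (Pi.single 2 1) (Pi.single 0 1),
    hsymm (Pi.single 2 1) (Pi.single 1 1),
    cross_swap (fderiv ℝ g t (Pi.single 1 1)) (fderiv ℝ (fderiv ℝ g) t (Pi.single 0 1) _),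
    cross_swap (fderiv ℝ g t (Pi.single 0 1)) (fderiv ℝ (fderiv ℝ g) t (Pi.single 1 1) _)]
  norm_num [inner_neg_right]
  linear_combination Real.exp (inner ℝ (g t) v) * (h1 + h2)

lemma sum_faces_flux_eq_zero (v : E3) (X : E3 → E3) {g : (Fin 3 → ℝ) → E3}
    (hg : ContDiffOn ℝ ∞ g (unitCube 3)) (hX : ContinuousOn (X ∘ g) (unitCube 3))
    (hB : ∀ t ∈ openCube 3, ∃ B : E3 →L[ℝ] E3,
      LinearMap.trace ℝ E3 B = -inner ℝ (X (g t)) v ∧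
        HasFDerivAt (X ∘ g) (B ∘L fderiv ℝ g t) t) :
    ∑ i : Fin 3, (-1 : ℝ) ^ (i : ℕ) *
      (flux v X (face i 1 (toCube g)) - flux v X (face i 0 (toCube g))) = 0 := by
  have hzero : ∀ t ∈ openCube 3, ∑ i : Fin 3, (-1 : ℝ) ^ (i : ℕ) *
      fderiv ℝ (faceDensity v g (X ∘ g) i) t (Pi.single i 1) = 0 := by
    intro t ht
    obtain ⟨B, hB1, hB2⟩ := hB t ht
    exact sum_faceDensity_deriv_eq_zero v hg ht hB1 hB2
  have hdiv := integral_divergence_of_hasFDerivAt_off_countable' (n := 2) (0 : Fin 3 → ℝ) 1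
    zero_le_one (fun i t => (-1 : ℝ) ^ (i : ℕ) * faceDensity v g (X ∘ g) i t)
    (fun i t => (-1 : ℝ) ^ (i : ℕ) • fderiv ℝ (faceDensity v g (X ∘ g) i) t) ∅ countable_empty
    (fun i => continuousOn_const.mul (continuousOn_faceDensity v hg hX i))
    (by
      rintro t ⟨ht, -⟩ i
      have ht' : t ∈ openCube 3 := by rw [openCube_eq_pi]; exact ht
      obtain ⟨B, -, hB2⟩ := hB t ht'
      obtain ⟨f', hf', -⟩ := hasFDerivAt_faceDensity v hg ht' hB2 i
      exact hf'.differentiableAt.hasFDerivAt.const_mul _)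
    (by
      -- The divergence vanishes on the open cube, hence almost everywhere, so no bound on the
      -- derivatives near the faces is needed.
      change IntegrableOn _ (unitCube 3) _
      refine IntegrableOn.congr_set_ae ?_ (openCube_ae_eq 3).symm
      refine (integrableOn_congr_fun (f := fun _ => (0 : ℝ)) (fun t ht => ?_)
        (isOpen_openCube 3).measurableSet).1 integrableOn_zero
      exact (hzero t ht).symm)
  have hl : ∫ t in Icc (0 : Fin 3 → ℝ) 1, ∑ i : Fin 3, ((-1 : ℝ) ^ (i : ℕ) •
      fderiv ℝ (faceDensity v g (X ∘ g) i) t) (Pi.single i 1) = 0 := by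
    change ∫ t in unitCube 3, _ = _
    rw [← setIntegral_congr_set (openCube_ae_eq 3)]
    exact setIntegral_eq_zero_of_forall_eq_zero fun t ht => hzero t ht
  rw [hl] at hdiv
  rw [hdiv]
  refine Finset.sum_congr rfl fun i _ => ?_
  rw [flux_face_toCube v X hg, flux_face_toCube v X hg, mul_sub, ← integral_const_mul,
    ← integral_const_mul]
  rfl

/-- A vector field whose flux form is closed along all smooth cubes in `A`, in the weak sense
that the pullbacks of the field are continuous, differentiable inside and have the right
divergence, has no flux through the boundaries of smooth chains of `A`. -/
lemma fluxChain_bd_eq_zero (v : E3) (X : E3 → E3) {A : Set E3}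
    (hX : ∀ g : (Fin 3 → ℝ) → E3, ContDiffOn ℝ ∞ g (unitCube 3) → MapsTo g (unitCube 3) A →
      ContinuousOn (X ∘ g) (unitCube 3) ∧ ∀ t ∈ openCube 3, ∃ B : E3 →L[ℝ] E3,
        LinearMap.trace ℝ E3 B = -inner ℝ (X (g t)) v ∧
          HasFDerivAt (X ∘ g) (B ∘L fderiv ℝ g t) t)
    {Ω : Chain 3 E3} (hΩ : Ω ∈ smoothChains 𝓘(ℝ, E3) 3 A) : fluxChain v X (bd Ω) = 0 := by
  have : smoothChains 𝓘(ℝ, E3) 3 A ≤ LinearMap.ker (fluxChain v X ∘ₗ bd) := by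
    refine Submodule.span_le.2 ?_
    rintro _ ⟨_, ⟨g, hg, rfl⟩, hA, rfl⟩
    have hgA : MapsTo g (unitCube 3) A := by
      intro t ht
      rw [← cubeExt_toCube g ht]
      exact hA _
    have hg' := contMDiffOn_iff_contDiffOn.1 hg
    obtain ⟨h1, h2⟩ := hX g hg' hgA
    have h := sum_faces_flux_eq_zero v X hg' h1 h2
    simp only [SetLike.mem_coe, LinearMap.mem_ker, LinearMap.comp_apply]
    rw [bd, cubeChain, Finsupp.linearCombination_single, one_smul, map_sum, ← h]
    refine Finset.sum_congr rfl fun i _ => ?_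
    rw [map_smul, map_sub, fluxChain_cubeChain, fluxChain_cubeChain, zsmul_eq_mul]
    push_cast
    rfl
  exact this hΩ

/-! ### Boundary curves are null sets -/

lemma hasFDerivWithinAt_comp_extChartAt_symm {M : Type*} [TopologicalSpace M]
    [ChartedSpace (EuclideanQuadrant 2) M] {G : M → E3} {p : M}
    (hG : MDifferentiableAt surfModel 𝓘(ℝ, E3) G p) :
    HasFDerivWithinAt (G ∘ (extChartAt surfModel p).symm)
      (mfderiv surfModel 𝓘(ℝ, E3) G p : EuclideanSpace ℝ (Fin 2) →L[ℝ] E3) (range surfModel)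
      (extChartAt surfModel p p) := by
  have h := hG.hasMFDerivAt.2
  simpa only [writtenInExtChartAt, extChartAt_model_space_eq_id, PartialEquiv.refl_coe,
    Function.id_comp] using h

namespace CompactSurface

/-- The differential of the immersion, as a map between Euclidean spaces. -/
noncomputable def dF (S : CompactSurface) (p : S.M) : EuclideanSpace ℝ (Fin 2) →L[ℝ] E3 :=
  mfderiv surfModel 𝓘(ℝ, E3) S.F p

/-- The differential of the Gauss map, as a map between Euclidean spaces. -/
noncomputable def dN (S : CompactSurface) (p : S.M) : EuclideanSpace ℝ (Fin 2) →L[ℝ] E3 :=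
  mfderiv surfModel 𝓘(ℝ, E3) S.N p

lemma mdifferentiableAt_F (S : CompactSurface) (p : S.M) :
    MDifferentiableAt surfModel 𝓘(ℝ, E3) S.F p := (S.smooth_F p).mdifferentiableAt (by simp)

lemma mdifferentiableAt_N (S : CompactSurface) (p : S.M) :
    MDifferentiableAt surfModel 𝓘(ℝ, E3) S.N p := (S.smooth_N p).mdifferentiableAt (by simp)

/-- Being a boundary point does not depend on the chart, so finitely many charts, centred anywhere,
suffice to cover the boundary. -/
lemma extChartAt_mem_frontier (S : CompactSurface) (q : S.M) {p : S.M}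
    (hp : p ∈ surfModel.boundary S.M) (hq : p ∈ (chartAt (EuclideanQuadrant 2) q).source) :
    extChartAt surfModel q p ∈ frontier (range surfModel) := by
  have h := (surfModel.isBoundaryPoint_iff_of_mem_atlas (n := ∞) (by simp)
    (chart_mem_atlas (EuclideanQuadrant 2) q) hq).1 hp
  refine ⟨subset_closure ⟨_, rfl⟩, fun hint => h.2 ?_⟩
  exact (chartAt (EuclideanQuadrant 2) q).mem_interior_extend_target
    ((chartAt (EuclideanQuadrant 2) q).map_source hq) hint

/-- Linear images in the plane of the boundary of a surface are null sets. -/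
lemma volume_image_bdry (S : CompactSurface) (P : E3 →L[ℝ] (Fin 2 → ℝ)) :
    volume (P '' S.bdry) = 0 := by
  obtain ⟨s, hs⟩ := (isCompact_univ (X := S.M)).elim_nhds_subcover
    (fun q => (chartAt (EuclideanQuadrant 2) q).source)
    (fun q _ => chart_source_mem_nhds (EuclideanQuadrant 2) q)
  let e : (Fin 2 → ℝ) ≃L[ℝ] EuclideanSpace ℝ (Fin 2) :=
    (EuclideanSpace.equiv (Fin 2) ℝ).symm
  let G : S.M → (Fin 2 → ℝ) → (Fin 2 → ℝ) := fun q => P ∘ S.F ∘ (extChartAt surfModel q).symm ∘ e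
  let Z : S.M → Set (Fin 2 → ℝ) := fun q =>
    e ⁻¹' ((extChartAt surfModel q).target ∩ frontier (range surfModel))
  have hsub : P '' S.bdry ⊆ ⋃ q ∈ s, G q '' Z q := by
    rintro _ ⟨_, ⟨p, hp, rfl⟩, rfl⟩
    obtain ⟨q, hq, hpq⟩ := mem_iUnion₂.1 (hs.2 (mem_univ p))
    refine mem_iUnion₂.2 ⟨q, hq, e.symm (extChartAt surfModel q p), ?_, ?_⟩
    · simp only [Z, mem_preimage, ContinuousLinearEquiv.apply_symm_apply]
      exact ⟨(extChartAt surfModel q).map_source (by rwa [extChartAt_source]),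
        S.extChartAt_mem_frontier q hp hpq⟩
    · simp only [G, Function.comp, ContinuousLinearEquiv.apply_symm_apply]
      rw [(extChartAt surfModel q).left_inv (by rwa [extChartAt_source])]
  refine measure_mono_null hsub ((measure_biUnion_null_iff s.countable_toSet).2 fun q _ => ?_)
  -- The frontier of a convex set is null, and differentiable maps between spaces of equal dimension
  -- preserve null sets.
  have hconv : Convex ℝ (e ⁻¹' range surfModel) :=
    surfModel.convex_range.linear_preimage e.toLinearEquiv.toLinearMap
  have hZ : volume (Z q) = 0 := by
    refine measure_mono_null ?_ (hconv.addHaar_frontier volume)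
    intro t ht
    have : frontier (e ⁻¹' range surfModel) = e ⁻¹' frontier (range surfModel) :=
      (e.toHomeomorph.preimage_frontier _).symm
    rw [this]
    exact ht.2
  refine addHaar_image_eq_zero_of_differentiableOn_of_addHaar_eq_zero volume ?_ hZ
  have h1 : ContMDiffOn 𝓘(ℝ, EuclideanSpace ℝ (Fin 2)) 𝓘(ℝ, E3) ∞
      (S.F ∘ (extChartAt surfModel q).symm) (extChartAt surfModel q).target :=
    S.smooth_F.comp_contMDiffOn (contMDiffOn_extChartAt_symm q)
  have h2 : DifferentiableOn ℝ (S.F ∘ (extChartAt surfModel q).symm)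
      (extChartAt surfModel q).target := (contMDiffOn_iff_contDiffOn.1 h1).differentiableOn (by simp)
  exact P.differentiable.comp_differentiableOn
    (h2.comp e.differentiable.differentiableOn fun t ht => ht.1)

end CompactSurface

/-! ### Graphs -/

/-- The projection along `v` onto the orthogonal plane. -/
noncomputable def projL (v : E3) : E3 →L[ℝ] (ℝ ∙ v)ᗮ := (ℝ ∙ v)ᗮ.orthogonalProjectionOnto

lemma projL_add_smul (v : E3) (x : (ℝ ∙ v)ᗮ) (t : ℝ) : projL v ((x : E3) + t • v) = x := by
  have h : projL v v = 0 := by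
    apply Submodule.orthogonalProjectionOnto_apply_of_mem_orthogonal
    rw [Submodule.orthogonal_orthogonal]
    exact Submodule.mem_span_singleton_self v
  rw [map_add, map_smul, h, smul_zero, add_zero]
  exact Submodule.orthogonalProjectionOnto_mem_subspace_eq_self x

namespace CompactSurface

variable {S : CompactSurface} {v : E3} {U : Set (ℝ ∙ v)ᗮ}

lemma IsGraphOver.exists_eq (h : S.IsGraphOver v U) :
    ∃ u : (ℝ ∙ v)ᗮ → ℝ, ContDiffOn ℝ ∞ u U ∧
      ∀ p, projL v (S.F p) ∈ U ∧ S.F p = (projL v (S.F p) : E3) + u (projL v (S.F p)) • v := by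
  obtain ⟨-, u, hu, hr⟩ := h
  refine ⟨u, hu, fun p => ?_⟩
  have hp : S.F p ∈ range S.F := ⟨p, rfl⟩
  rw [hr] at hp
  obtain ⟨x, hx, hpx⟩ := hp
  rw [hpx, projL_add_smul]
  exact ⟨hx, rfl⟩

lemma IsGraphOver.injective_proj (h : S.IsGraphOver v U) :
    Function.Injective fun p => projL v (S.F p) := by
  obtain ⟨u, -, hp⟩ := h.exists_eq
  intro p q hpq
  refine h.1 ?_
  rw [(hp p).2, (hp q).2]
  simp only at hpq
  rw [hpq]

lemma IsGraphOver.range_subset (h : S.IsGraphOver v U) : range S.F ⊆ cylinder v U := by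
  obtain ⟨u, -, hp⟩ := h.exists_eq
  rintro _ ⟨p, rfl⟩
  exact ⟨_, (hp p).1, _, (hp p).2⟩

lemma IsGraphOver.exists_proj_eq (h : S.IsGraphOver v U) {y : E3} (hy : y ∈ cylinder v U) :
    ∃ p, projL v (S.F p) = projL v y := by
  obtain ⟨-, u, -, hr⟩ := h
  obtain ⟨x, hx, t, rfl⟩ := hy
  have : (x : E3) + u x • v ∈ range S.F := by rw [hr]; exact ⟨x, hx, rfl⟩
  obtain ⟨p, hp⟩ := this
  exact ⟨p, by rw [hp, projL_add_smul, projL_add_smul]⟩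

/-- A graph has no tangent vectors in the direction of `v`. -/
lemma IsGraphOver.injective_proj_mfderiv (h : S.IsGraphOver v U) (p : S.M) :
    Function.Injective (projL v ∘L S.dF p) := by
  obtain ⟨u, hu, hp⟩ := h.exists_eq
  set D := S.dF p
  set φ := extChartAt surfModel p
  have hF : HasFDerivWithinAt (S.F ∘ φ.symm) D (range surfModel) (φ p) :=
    hasFDerivWithinAt_comp_extChartAt_symm (S.mdifferentiableAt_F p)
  have hx : HasFDerivWithinAt (fun s => projL v (S.F (φ.symm s))) (projL v ∘L D)
      (range surfModel) (φ p) := (projL v).hasFDerivAt.comp_hasFDerivWithinAt _ hF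
  -- Derivatives within `U` need not be unique; any one will do. Uniqueness is used only on the
  -- range of the model, to get `D w = π D w + du(π D w) v`, where `π` is the projection.
  have hu' : HasFDerivWithinAt u (fderivWithin ℝ u U (projL v (S.F (φ.symm (φ p))))) U
      (projL v (S.F (φ.symm (φ p)))) :=
    (hu.differentiableOn (by simp) _ (hp _).1).hasFDerivWithinAt
  have hux := hu'.comp (φ p) hx fun s _ => (hp _).1
  have hsum := ((ℝ ∙ v)ᗮ.subtypeL.hasFDerivAt.comp_hasFDerivWithinAt _ hx).add
    (hux.smul_const v)
  have hFeq : S.F ∘ φ.symm = fun s => (projL v (S.F (φ.symm s)) : E3) +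
      u (projL v (S.F (φ.symm s))) • v := funext fun s => (hp _).2
  rw [hFeq] at hF
  have hDeq := (surfModel.uniqueDiffOn _ (mem_range_self _)).eq hF hsum
  refine (injective_iff_map_eq_zero _).2 fun w hw => ?_
  have hw' : projL v (D w) = 0 := hw
  refine S.immersion p ?_
  change D w = D 0
  have hDw := DFunLike.congr_fun hDeq w
  simp only [add_apply, ContinuousLinearMap.comp_apply,
    ContinuousLinearMap.smulRight_apply, hw', map_zero, zero_smul, add_zero] at hDw
  rw [map_zero, hDw]

/-- The Gauss map of a graph, extended to the cylinder by vertical translations. -/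
noncomputable def extendedNormal (S : CompactSurface) (v : E3) (y : E3) : E3 :=
  open scoped Classical in
  if h : ∃ p, projL v (S.F p) = projL v y then S.N h.choose else 0

lemma IsGraphOver.extendedNormal_eq (h : S.IsGraphOver v U) {p : S.M} {y : E3}
    (hp : projL v (S.F p) = projL v y) : S.extendedNormal v y = S.N p := by
  have hex : ∃ p, projL v (S.F p) = projL v y := ⟨p, hp⟩
  rw [extendedNormal, dif_pos hex]
  congr 1
  exact h.injective_proj (hex.choose_spec.trans hp.symm)

/-- The default value `0` away from the vertical lines through the graph keeps the bound valid in
all of space. -/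
lemma norm_extendedNormal_le (S : CompactSurface) (v y : E3) : ‖S.extendedNormal v y‖ ≤ 1 := by
  rw [extendedNormal]
  split_ifs
  · exact (S.unit_N _).le
  · simp

/-- The differential of the extended Gauss map has the trace `-H`. -/
lemma IsGraphOver.exists_trace (h : S.IsGraphOver v U) {p : S.M} {H : ℝ}
    (hH : S.HasMeanCurvatureAt p H) : ∃ R : (ℝ ∙ v)ᗮ →L[ℝ] EuclideanSpace ℝ (Fin 2),
      Function.LeftInverse R (projL v ∘L S.dF p) ∧
      LinearMap.trace ℝ E3 (S.dN p ∘L (R ∘L projL v) : E3 →L[ℝ] E3) = -H := by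
  obtain ⟨A, hA, rfl⟩ := hH
  set D := S.dF p
  set D' := S.dN p
  let A' : EuclideanSpace ℝ (Fin 2) →ₗ[ℝ] EuclideanSpace ℝ (Fin 2) := A
  have hA' : ∀ w, D' w = -D (A' w) := fun w => by rw [← neg_eq_iff_eq_neg]; exact (hA w).symm
  obtain ⟨R₀, hR₀⟩ := LinearMap.exists_leftInverse_of_injective
    ((projL v ∘L D : EuclideanSpace ℝ (Fin 2) →L[ℝ] (ℝ ∙ v)ᗮ) :
      EuclideanSpace ℝ (Fin 2) →ₗ[ℝ] (ℝ ∙ v)ᗮ)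
    (LinearMap.ker_eq_bot.2 (h.injective_proj_mfderiv p))
  have hR : ∀ w, R₀ (projL v (D w)) = w := fun w => LinearMap.congr_fun hR₀ w
  refine ⟨LinearMap.toContinuousLinearMap R₀, hR, ?_⟩
  have h1 : ((D' ∘L (LinearMap.toContinuousLinearMap R₀ ∘L projL v) : E3 →L[ℝ] E3) :
      E3 →ₗ[ℝ] E3) = -((D : EuclideanSpace ℝ (Fin 2) →ₗ[ℝ] E3) ∘ₗ
        (A' ∘ₗ R₀ ∘ₗ (projL v : E3 →ₗ[ℝ] (ℝ ∙ v)ᗮ))) := by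
    ext1 y
    simp [hA']
  -- Cyclicity of the trace moves `D` to the right, where `R₀` cancels the projected differential
  -- and leaves the trace of the shape operator.
  have h2 : (A' ∘ₗ R₀ ∘ₗ (projL v : E3 →ₗ[ℝ] (ℝ ∙ v)ᗮ)) ∘ₗ
      (D : EuclideanSpace ℝ (Fin 2) →ₗ[ℝ] E3) = A' := by
    ext1 w
    simp [hR]
  rw [h1, map_neg, LinearMap.trace_comp_comm', h2]
  rfl

/-- The pullback of the extended Gauss map of a soliton graph by a smooth cube in the cylinder is
continuous, is differentiable inside, and has divergence `-H`. -/
lemma IsGraphOver.extendedNormal_comp (h : S.IsGraphOver v U) (hsol : S.IsTranslatingSoliton v 0)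
    {n : ℕ} {g : (Fin n → ℝ) → E3} (hg : ContDiffOn ℝ ∞ g (unitCube n))
    (hgU : MapsTo g (unitCube n) (cylinder v U)) :
    ContinuousOn (S.extendedNormal v ∘ g) (unitCube n) ∧ ∀ t ∈ openCube n, ∃ B : E3 →L[ℝ] E3,
      LinearMap.trace ℝ E3 B = -inner ℝ (S.extendedNormal v (g t)) v ∧
        HasFDerivAt (S.extendedNormal v ∘ g) (B ∘L fderiv ℝ g t) t := by
  rcases isEmpty_or_nonempty S.M with hM | hM
  · have hemp : ∀ t, t ∉ unitCube n := fun t ht => hM.false (h.exists_proj_eq (hgU ht)).choose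
    exact ⟨fun t ht => (hemp t ht).elim, fun t ht => (hemp t (openCube_subset n ht)).elim⟩
  have hlift : ∀ t, ∃ p, t ∈ unitCube n → projL v (S.F p) = projL v (g t) := by
    intro t
    by_cases ht : t ∈ unitCube n
    · obtain ⟨p, hp⟩ := h.exists_proj_eq (hgU ht)
      exact ⟨p, fun _ => hp⟩
    · exact ⟨hM.some, fun ht' => (ht ht').elim⟩
  choose q hq using hlift
  have hXq : EqOn (S.extendedNormal v ∘ g) (S.N ∘ q) (unitCube n) := fun t ht =>
    h.extendedNormal_eq (hq t ht)
  -- Compactness makes the injective projection an embedding, so the lift `q t`, the point of the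
  -- surface on the vertical line through `g t`, is continuous.
  have hemb : Topology.IsClosedEmbedding fun p => projL v (S.F p) :=
    ((projL v).continuous.comp S.smooth_F.continuous).isClosedEmbedding h.injective_proj
  have hqc : ContinuousOn q (unitCube n) := by
    rw [hemb.isInducing.continuousOn_iff]
    exact ((projL v).continuous.comp_continuousOn hg.continuousOn).congr hq
  refine ⟨(S.smooth_N.continuous.comp_continuousOn hqc).congr hXq, fun t ht => ?_⟩
  have htn := unitCube_mem_nhds ht
  have htU := openCube_subset n ht
  obtain ⟨R, hR, htr⟩ := h.exists_trace (hsol (q t))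
  refine ⟨_, htr.trans ?_, ?_⟩
  · rw [h.extendedNormal_eq (hq t htU), add_zero]
  set φ := extChartAt surfModel (q t)
  have hqt : ContinuousAt q t := hqc.continuousAt htn
  have hsrc : ∀ᶠ s in nhds t, q s ∈ φ.source :=
    hqt.eventually_mem (extChartAt_source_mem_nhds (q t))
  have hkc : ContinuousAt (φ ∘ q) t :=
    (continuousAt_extChartAt (I := surfModel) (q t)).comp hqt
  have hktend : Filter.Tendsto (φ ∘ q) (nhds t) (nhdsWithin ((φ ∘ q) t) (range surfModel)) := by
    refine tendsto_nhdsWithin_iff.2 ⟨hkc, ?_⟩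
    filter_upwards with s
    exact mem_range_self (f := surfModel) _
  have hF : HasFDerivWithinAt (fun s => projL v (S.F (φ.symm s))) (projL v ∘L S.dF (q t))
      (range surfModel) ((φ ∘ q) t) :=
    (projL v).hasFDerivAt.comp_hasFDerivWithinAt _
      (hasFDerivWithinAt_comp_extChartAt_symm (S.mdifferentiableAt_F (q t)))
  have hN : HasFDerivWithinAt (S.N ∘ φ.symm) (S.dN (q t))
      (range surfModel) ((φ ∘ q) t) :=
    hasFDerivWithinAt_comp_extChartAt_symm (S.mdifferentiableAt_N (q t))
  have hgd : HasFDerivAt (fun s => projL v (g s)) (projL v ∘L fderiv ℝ g t) t :=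
    (projL v).hasFDerivAt.comp t
      (((hg t htU).contDiffAt htn).differentiableAt (by simp)).hasFDerivAt
  -- Since the projected `F` composed with `q` is the projected `g`, continuity of `q` and the left
  -- inverse `R` give the derivative of `q` in the chart. This also works at boundary and corner
  -- points of the surface.
  have hk : HasFDerivWithinAt (φ ∘ q) (R ∘L (projL v ∘L fderiv ℝ g t)) univ t := by
    refine HasFDerivWithinAt.of_comp_of_leftInverse (t := range surfModel)
      (by rwa [nhdsWithin_univ]) hF hgd.hasFDerivWithinAt ?_ hR (mem_univ t)
    rw [nhdsWithin_univ]
    filter_upwards [hsrc, htn] with s hs hs'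
    simp only [Function.comp, φ.left_inv hs, hq s hs']
  have hNk := hN.comp t hk fun s _ => mem_range_self (f := surfModel) _
  rw [hasFDerivWithinAt_univ] at hNk
  refine hNk.congr_of_eventuallyEq ?_
  filter_upwards [hsrc, htn] with s hs hs'
  rw [hXq hs']
  simp only [Function.comp, φ.left_inv hs]

/-! ### Calibration -/

lemma Subdivision.contDiffOn (K : S.Subdivision) (i : Fin K.num) :
    ContDiffOn ℝ ∞ (S.F ∘ K.cell i) (unitCube 2) :=
  contMDiffOn_iff_contDiffOn.1 (S.smooth_F.comp_contMDiffOn (K.smooth i))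

lemma Subdivision.fluxChain_chain (K : S.Subdivision) (v : E3) (X : E3 → E3) :
    fluxChain v X K.chain = ∑ i, ∫ t in unitCube 2,
      fluxDensity v (S.F ∘ K.cell i) (X ∘ S.F ∘ K.cell i) t := by
  simp only [chain, map_sum, fluxChain_cubeChain, flux_toCube]

/-- The flux of a field of length at most one is bounded by the weighted area. -/
lemma Subdivision.fluxChain_le_weightedArea (K : S.Subdivision) (v : E3) {X : E3 → E3}
    (hX : ∀ y, ‖X y‖ ≤ 1) : fluxChain v X K.chain ≤ K.weightedArea v := by
  rw [K.fluxChain_chain, weightedArea]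
  refine Finset.sum_le_sum fun i _ => ?_
  refine (le_abs_self _).trans ?_
  rw [← Real.norm_eq_abs]
  have hD : ContinuousOn (fderivWithin ℝ (S.F ∘ K.cell i) (unitCube 2)) (unitCube 2) :=
    (K.contDiffOn i).continuousOn_fderivWithin (uniqueDiffOn_unitCube 2) (by simp)
  have hcr : Continuous fun p : E3 × E3 => cross p.1 p.2 :=
    (crossL.continuous.comp continuous_fst).clm_apply continuous_snd
  refine norm_integral_le_of_norm_le (ContinuousOn.integrableOn_compact (isCompact_unitCube 2) ?_)
    (Filter.Eventually.of_forall fun t => ?_)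
  · refine ContinuousOn.mul ?_ ?_
    · exact Real.continuous_exp.comp_continuousOn
        ((K.contDiffOn i).continuousOn.inner continuousOn_const)
    · exact (hcr.comp_continuousOn
        ((hD.clm_apply continuousOn_const).prodMk (hD.clm_apply continuousOn_const))).norm
  · rw [fluxDensity, norm_mul, Real.norm_of_nonneg (Real.exp_pos _).le]
    refine mul_le_mul_of_nonneg_left ?_ (Real.exp_pos _).le
    refine (norm_inner_le_norm _ _).trans ?_
    exact mul_le_of_le_one_left (norm_nonneg _) (hX _)

/-- The extended Gauss map calibrates the graph. -/
lemma IsGraphOver.fluxChain_eq_weightedArea (h : S.IsGraphOver v U) (K : S.Subdivision) :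
    fluxChain v (S.extendedNormal v) K.chain = K.weightedArea v := by
  rw [K.fluxChain_chain, Subdivision.weightedArea]
  refine Finset.sum_congr rfl fun i _ => ?_
  -- Cells are known to be positively oriented only in the open square, which has full measure.
  rw [← setIntegral_congr_set (openCube_ae_eq 2), ← setIntegral_congr_set (openCube_ae_eq 2)]
  refine setIntegral_congr_fun (isOpen_openCube 2).measurableSet fun t ht => ?_
  have hX : S.extendedNormal v (S.F (K.cell i t)) = S.N (K.cell i t) := h.extendedNormal_eq rfl
  have htan : ∀ w, inner ℝ (S.N (K.cell i t))
      (fderivWithin ℝ (S.F ∘ K.cell i) (unitCube 2) t w) = 0 := by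
    intro w
    obtain ⟨c', hc⟩ : ∃ c' : (Fin 2 → ℝ) →L[ℝ] EuclideanSpace ℝ (Fin 2),
        HasMFDerivWithinAt 𝓘(ℝ, Fin 2 → ℝ) surfModel (K.cell i) (unitCube 2) t c' :=
      ⟨_, ((K.smooth i t (openCube_subset 2 ht)).mdifferentiableWithinAt
        (by simp)).hasMFDerivWithinAt⟩
    have hf : HasFDerivWithinAt (S.F ∘ K.cell i) (S.dF (K.cell i t) ∘L c') (unitCube 2) t :=
      ((S.mdifferentiableAt_F (K.cell i t)).hasMFDerivAt.comp_hasMFDerivWithinAt t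
        hc).hasFDerivWithinAt
    rw [hf.fderivWithin (uniqueDiffOn_unitCube 2 t (openCube_subset 2 ht))]
    exact S.normal_N _ _
  simp only [fluxDensity, Function.comp_apply, hX]
  congr 1
  exact inner_cross_eq_norm (S.unit_N _) (htan _) (htan _) (K.oriented i t ht).le

end CompactSurface

lemma InClass.refl {v : E3} {U : Set (ℝ ∙ v)ᗮ} {S : CompactSurface} (K : S.Subdivision)
    (h : S.IsGraphOver v U) : InClass v U K K :=
  ⟨h.range_subset, rfl, 0, zero_mem _, 0, zero_mem _, 0, zero_mem _, by simp⟩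

theorem corollary3p4 (v : E3) (hv : ‖v‖ = 1) (U : Set (ℝ ∙ v)ᗮ)
    (S : CompactSurface) (K : S.Subdivision)
    (hsol : S.IsTranslatingSoliton v 0) (hgraph : S.IsGraphOver v U) :
    InClass v U K K ∧
      ∀ (T : CompactSurface) (L : T.Subdivision), InClass v U K L →
        K.weightedArea v ≤ L.weightedArea v := by
  refine ⟨InClass.refl K hgraph, fun T L ⟨_, _, Ω, hΩ, γ, hγ, δ, hδ, heq⟩ => ?_⟩
  have hflux := congrArg (fluxChain v (S.extendedNormal v)) heq
  rw [map_sub, map_add, map_add, fluxChain_eq_zero_of_null v _ S.volume_image_bdry hγ,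
    fluxChain_eq_zero_of_mem_degenerateChains v _ hδ,
    fluxChain_bd_eq_zero v _ (fun g hg hgU => hgraph.extendedNormal_comp hsol hg hgU) hΩ,
    hgraph.fluxChain_eq_weightedArea K] at hflux
  have hle := L.fluxChain_le_weightedArea v (S.norm_extendedNormal_le v)
  linarith
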